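/- Define cardinals $\lambda_0=\omega_0$, $\lambda_{n+1}=2^{\lambda_n}$ for $n\in\mathbb N_0$, and $\lambda=\sup_n\lambda_n$ (that is, $\lambda=\beth_\omega$). For a set $\Gamma$, $c_0(\Gamma)$ is the real Banach space of all $f:\Gamma\to\mathbb R$ such that $\{\gamma:|f(\gamma)|\ge\varepsilon\}$ is finite for every $\varepsilon>0$, with the supremum norm. For a map $f:M_1\to M_2$ between metric spaces put $$w_f(t)=\sup\{d_2(f(x),f(y)):d_1(x,y)\le t\},\qquad \rho_f(t)=\inf\{d_2(f(x),f(y)):d_1(x,y)\ge t\},$$ with values in $[0,\infty]$. The map $f$ is a uniform embedding if $\lim_{t\to0}w_f(t)=0$ and $\rho_f(t)>0$ for all $t>0$; it is a coarse embedding if $w_f(t)<\infty$ for all $0<t<\infty$ and $\lim_{t\to\infty}\rho_f(t)=\infty$. A transfinite series $\sum_{\gamma<\mu}x_\gamma$ ($\mu$ an ordinal) in a Banach space converges to $x$ if there is a continuous function $S$ on the ordinal interval $[0,\mu]$ with $S(0)=0$, $S(\gamma+1)=S(\gamma)+x_\gamma$ for $\gamma<\mu$, and $S(\mu)=x$. A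 family $(e_\gamma)_{\gamma<\mu}$ in a real Banach space $X$ is a long Schauder basis of $X$ if for every $x\in X$ there is a unique family of scalars $(a_\gamma)_{\gamma<\mu}$ with $x=\sum_{\gamma<\mu}a_\gamma e_\gamma$. It is symmetric if $$\Big\|\sum_{i=1}^n a_ie_{\gamma_i}\Big\|=\Big\|\sum_{i=1}^n a_ie_{\beta_i}\Big\|$$ for all $n$, all $a_1,\dots,a_n\in\mathbb R$, all distinct $\gamma_1,\dots,\gamma_n<\mu$ and all distinct $\beta_1,\dots,\beta_n<\mu$. **Theorem.** Let $X$ be a real Banach space whose density (the least cardinality of a dense subset) is $\Lambda\ge\lambda$, and suppose that $X$ has a symmetric long Schauder basis $(e_\gamma)_{\gamma<\mu}$ of some length $\mu$ (for instance $\mu=\Lambda$). If $X$ coarsely embeds or uniformly embeds into $c_0(\Gamma)$ for some set $\Gamma$, then $X$ is linearly isomorphic (by a bounded linear bijection with bounded inverse) to $c_0(\Lambda)$. -/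

import Mathlib

universe u v

open Filter Topology
open scoped ENNReal Cardinal Ordinal

noncomputable section

/-- The density of a topological space: the least cardinality of a dense subset. -/
def topDensity (X : Type u) [TopologicalSpace X] : Cardinal.{u} :=
  sInf {c : Cardinal.{u} | ∃ s : Set X, Dense s ∧ #s = c}

/-- The real Banach space `c₀(Γ)`: all bounded functions `f : Γ → ℝ` such that `{γ | ε ≤ |f γ|}`
is finite for every `ε > 0` (that is, `f → 0` along the cofinite filter of `Γ`), as a subspace of
`ℓ_∞(Γ)`, with the supremum norm. -/
def c0Space (Γ : Type v) : Submodule ℝ (lp (fun _ : Γ => ℝ) ∞) where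
  carrier := {f | Tendsto (fun γ => f γ) cofinite (𝓝 0)}
  add_mem' := by
    intro f g hf hg
    simpa using Tendsto.add (Set.mem_ofPred.1 hf) (Set.mem_ofPred.1 hg)
  zero_mem' := by
    simpa using (tendsto_const_nhds : Tendsto (fun _ : Γ => (0 : ℝ)) cofinite (𝓝 0))
  smul_mem' := by
    intro c f hf
    simpa using Tendsto.const_mul c (Set.mem_ofPred.1 hf)

section Embeddings

variable {M₁ : Type u} {M₂ : Type v} [MetricSpace M₁] [MetricSpace M₂]

/-- Modulus of uniform continuity `w_f(t) = sup {d(f x, f y) : d(x, y) ≤ t}`, valued in `[0,∞]`. -/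
def modulusContinuity (f : M₁ → M₂) (t : ℝ) : ℝ≥0∞ :=
  ⨆ (x : M₁) (y : M₁) (_ : dist x y ≤ t), edist (f x) (f y)

/-- Modulus of expansion `ρ_f(t) = inf {d(f x, f y) : d(x, y) ≥ t}`, valued in `[0,∞]`
(with `inf ∅ = ∞`). -/
def modulusExpansion (f : M₁ → M₂) (t : ℝ) : ℝ≥0∞ :=
  ⨅ (x : M₁) (y : M₁) (_ : t ≤ dist x y), edist (f x) (f y)

/-- `f` is a uniform embedding: `w_f(t) → 0` as `t → 0`, and `ρ_f(t) > 0` for every `t > 0`. -/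
def IsUniformEmb (f : M₁ → M₂) : Prop :=
  Tendsto (modulusContinuity f) (𝓝[>] 0) (𝓝 0) ∧ ∀ t : ℝ, 0 < t → 0 < modulusExpansion f t

/-- `f` is a coarse embedding: `w_f(t) < ∞` for every `0 < t < ∞`, and `ρ_f(t) → ∞` as
`t → ∞`. -/
def IsCoarseEmb (f : M₁ → M₂) : Prop :=
  (∀ t : ℝ, 0 < t → modulusContinuity f t < ∞) ∧ Tendsto (modulusExpansion f) atTop (𝓝 ∞)

end Embeddings

section LongBases

variable {X : Type u} [NormedAddCommGroup X]

/-- The transfinite series `∑_{γ < o} x γ` converges to `s`: there are partial sums `S α`,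
`α ≤ o`, with `S 0 = 0`, `S (γ + 1) = S γ + x γ` for `γ < o`, and `S o = s`, which depend
continuously on `α ∈ [0, o]` in the order topology (so that `S α = lim_{β < α} S β` at limit
ordinals `α ≤ o`). The values of `S` above `o` are irrelevant. -/
def HasTransfiniteSum {o : Ordinal.{v}} (x : Set.Iio o → X) (s : X) : Prop :=
  ∃ S : Ordinal.{v} → X, ContinuousOn S (Set.Iic o) ∧ S 0 = 0 ∧
    (∀ γ : Set.Iio o, S (Order.succ (γ : Ordinal.{v})) = S γ + x γ) ∧ S o = s

variable [NormedSpace ℝ X]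

/-- `(e γ)_{γ < o}` is a long Schauder basis of `X`: every `x` has a unique transfinite sequence of
scalars `(a γ)_{γ < o}` with `x = ∑_{γ < o} a γ • e γ`. -/
def IsLongSchauderBasis {o : Ordinal.{v}} (e : Set.Iio o → X) : Prop :=
  ∀ x : X, ∃! a : Set.Iio o → ℝ, HasTransfiniteSum (fun γ => a γ • e γ) x

/-- A symmetric long Schauder basis: moreover `‖∑ aᵢ e_{γᵢ}‖ = ‖∑ aᵢ e_{βᵢ}‖` for all real
`a₁, …, aₙ`, all distinct indices `γ₁, …, γₙ` and all distinct indices `β₁, …, βₙ`. -/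
structure IsSymmetricLongBasis {o : Ordinal.{v}} (e : Set.Iio o → X) : Prop where
  isLongSchauderBasis : IsLongSchauderBasis e
  norm_sum_eq : ∀ (n : ℕ) (a : Fin n → ℝ) (γ β : Fin n → Set.Iio o),
    Function.Injective γ → Function.Injective β →
      ‖∑ i, a i • e (γ i)‖ = ‖∑ i, a i • e (β i)‖

end LongBases

end

/-! ### Coarse and uniform embeddings at a single scale -/

section Moduli

variable {M₁ : Type u} {M₂ : Type v} [MetricSpace M₁] [MetricSpace M₂]

/-! Either kind of embedding `f` supplies constants such that moves of length at most `t` change `f`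
by at most `M`, while points whose images are within `4 * M` are within `D`. Round the coordinates
of `f` at scale `4 * M`. Near a fixed point of `c₀(Γ)` the rounded values vanish off a finite set,
so only countably many labels occur there; yet equal labels force distance at most `D`.

Now map a product of `n` index sets to `X` by `s ↦ ∑ τ cᵢ e_{sᵢ}`, with `τ` so small that changing
one coordinate moves the point by at most `t`. Labels are then countable on every axis-parallel
line. Since the index set has size at least `ℶ_ω`, the factors can grow fast enough for a pigeonhole
argument to give two points with the same label that differ in every coordinate
(`exists_eq_of_countable_lines`). Symmetry turns this into a bound `‖∑ cᵢ (e_{aᵢ} - e_{bᵢ})‖ ≤ K`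
independent of `n`.

To remove the `e_{bᵢ}`, average over many disjoint choices of them. Dyadic averages of basis vectors
are Cauchy by the same bound, and their limit has all coordinates zero, hence is zero
(`IsSymmetricFamily.tendsto_average`). This gives the upper `c₀` estimate
`IsSymmetricFamily.norm_sum_le`. The lower one, `IsSymmetricFamily.abs_coeff_mul_le`, follows from
symmetry by exchanging one index for a fresh one. -/

theorem dist_le_of_modulusContinuity_le {f : M₁ → M₂} {t M : ℝ} (hM : 0 ≤ M)
    (h : modulusContinuity f t ≤ ENNReal.ofReal M) {x y : M₁} (hxy : dist x y ≤ t) :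
    dist (f x) (f y) ≤ M := by
  have h1 : edist (f x) (f y) ≤ modulusContinuity f t :=
    le_iSup_of_le x (le_iSup_of_le y (le_iSup_of_le hxy le_rfl))
  rw [edist_dist] at h1
  exact (ENNReal.ofReal_le_ofReal_iff hM).1 (h1.trans h)

theorem dist_le_of_lt_modulusExpansion {f : M₁ → M₂} {t M : ℝ}
    (h : ENNReal.ofReal M < modulusExpansion f t) {x y : M₁} (hxy : dist (f x) (f y) ≤ M) :
    dist x y ≤ t := by
  by_contra! hlt
  have h1 : modulusExpansion f t ≤ edist (f x) (f y) :=
    iInf_le_of_le x (iInf_le_of_le y (iInf_le_of_le hlt.le le_rfl))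
  rw [edist_dist] at h1
  exact absurd (h.trans_le h1) (not_lt.2 (ENNReal.ofReal_le_ofReal hxy))

/-- Both coarse and uniform embeddings control distances from both sides at one scale. -/
theorem exists_scale_of_isCoarseEmb_or_isUniformEmb {f : M₁ → M₂}
    (hf : IsCoarseEmb f ∨ IsUniformEmb f) :
    ∃ t M D : ℝ, 0 < t ∧ 0 < M ∧ (∀ x y, dist x y ≤ t → dist (f x) (f y) ≤ M) ∧
      ∀ x y, dist (f x) (f y) ≤ 4 * M → dist x y ≤ D := by
  rcases hf with ⟨h1, h2⟩ | ⟨h1, h2⟩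
  -- Coarse case: `t = 1`, and `D` exists because the expansion modulus eventually exceeds `4 * M`.
  -- The `+ 1` only makes `M` positive.
  · set M : ℝ := (modulusContinuity f 1).toReal + 1 with hM
    have hM0 : 0 < M := by positivity
    obtain ⟨D, hD⟩ := (h2.eventually (lt_mem_nhds
      (ENNReal.ofReal_lt_top (r := 4 * M)))).exists
    refine ⟨1, M, D, one_pos, hM0, fun x y hxy => ?_,
      fun x y hxy => dist_le_of_lt_modulusExpansion hD hxy⟩
    refine dist_le_of_modulusContinuity_le hM0.le ?_ hxy
    rw [← ENNReal.ofReal_toReal (h1 1 one_pos).ne]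
    exact ENNReal.ofReal_le_ofReal (by linarith)
  -- Uniform case: fix `D = 1` first, with `r` below the expansion modulus at `1`; then `M = r / 4`,
  -- and `t` is small enough for this `M`.
  · obtain ⟨r, hr0, hr⟩ := ENNReal.lt_iff_exists_real_btwn.1 (h2 1 one_pos)
    have hr0' : 0 < r := by simpa using hr.1
    have hev : ∀ᶠ t in 𝓝[>] (0 : ℝ), modulusContinuity f t < ENNReal.ofReal (r / 4) :=
      h1.eventually (gt_mem_nhds (by simpa using hr0'))
    obtain ⟨t, ht, ht0⟩ := (hev.and self_mem_nhdsWithin).exists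
    refine ⟨t, r / 4, 1, ht0, by positivity,
      fun x y hxy => dist_le_of_modulusContinuity_le (by positivity) ht.le hxy,
      fun x y hxy => dist_le_of_lt_modulusExpansion hr.2 (by linarith)⟩

end Moduli

/-! ### Rounding in `c₀(Γ)` -/

section Labels

/-- The coordinatewise rounding of a function at scale `4 * M`. -/
noncomputable def roundLabel {Γ : Type v} (M : ℝ) (y : Γ → ℝ) (γ : Γ) : ℤ := round (y γ / (4 * M))

theorem c0Space_abs_sub_le {Γ : Type v} (y z : c0Space Γ) (γ : Γ) :
    |y.1 γ - z.1 γ| ≤ dist y z := by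
  rw [dist_eq_norm]
  exact lp.norm_apply_le_norm ENNReal.top_ne_zero (y.1 - z.1) γ

theorem c0Space_finite_le_abs {Γ : Type v} (y : c0Space Γ) {M : ℝ} (hM : 0 < M) :
    {γ | M ≤ |y.1 γ|}.Finite := by
  have h : Tendsto (fun γ => y.1 γ) cofinite (𝓝 0) := y.2
  have := (Metric.tendsto_nhds.1 h) M hM
  rw [eventually_cofinite] at this
  simpa using this

theorem dist_le_of_roundLabel_eq {Γ : Type v} {M : ℝ} (hM : 0 < M) {y z : c0Space Γ}
    (h : roundLabel M y.1 = roundLabel M z.1) : dist y z ≤ 4 * M := by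
  rw [dist_eq_norm]
  refine lp.norm_le_of_forall_le (by positivity) fun γ => ?_
  have h1 := abs_sub_round (y.1 γ / (4 * M))
  have h2 := abs_sub_round (z.1 γ / (4 * M))
  have h3 : round (y.1 γ / (4 * M)) = round (z.1 γ / (4 * M)) := congrFun h γ
  rw [h3] at h1
  have h4 : |y.1 γ / (4 * M) - z.1 γ / (4 * M)| ≤ 1 := by
    rw [abs_le] at *; constructor <;> linarith
  rw [← sub_div, abs_div, abs_of_pos (by positivity : 0 < 4 * M), div_le_one (by positivity)] at h4
  exact h4

/-- The scale `4 * M` is chosen for this: a coordinate below `M` at `z` stays below `2 * M` in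
absolute value at `y`, less than half a unit after rescaling. -/
theorem roundLabel_eq_zero_of_dist_le {Γ : Type v} {M : ℝ} (hM : 0 < M) {y z : c0Space Γ}
    (h : dist y z ≤ M) {γ : Γ} (hγ : |z.1 γ| < M) : roundLabel M y.1 γ = 0 := by
  have h1 : |y.1 γ| < 2 * M := by
    have := (c0Space_abs_sub_le y z γ).trans h
    rw [abs_le] at this; rw [abs_lt] at *; constructor <;> linarith
  rw [roundLabel, round_eq_zero_iff]
  rw [abs_lt] at h1
  constructor
  · rw [le_div_iff₀ (by positivity)]; linarith
  · rw [div_lt_iff₀ (by positivity)]; linarith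

theorem countable_setOf_eq_zero_off_finite {Γ : Type v} {A : Set Γ} (hA : A.Finite) :
    {g : Γ → ℤ | ∀ γ ∉ A, g γ = 0}.Countable := by
  have := hA.to_subtype
  have : Set.InjOn (fun (g : Γ → ℤ) (a : A) => g a) {g : Γ → ℤ | ∀ γ ∉ A, g γ = 0} := by
    intro g hg g' hg' h
    funext γ
    by_cases hγ : γ ∈ A
    · exact congrFun h ⟨γ, hγ⟩
    · rw [hg γ hγ, hg' γ hγ]
  exact Set.MapsTo.countable_of_injOn (Set.mapsTo_univ _ _) this Set.countable_univ

theorem countable_roundLabel_image {Γ : Type v} {M : ℝ} (hM : 0 < M) (z : c0Space Γ) :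
    {g | ∃ y : c0Space Γ, dist y z ≤ M ∧ roundLabel M y.1 = g}.Countable := by
  refine (countable_setOf_eq_zero_off_finite (c0Space_finite_le_abs z hM)).mono ?_
  rintro g ⟨y, hy, rfl⟩ γ hγ
  exact roundLabel_eq_zero_of_dist_le hM hy (not_le.1 hγ)

end Labels

/-! ### Colourings of products of rapidly growing sets -/

section Boxes

/-- A countable colouring of a product of sets, each much larger than the product of the previous
ones, is constant on some box with two points in each coordinate. -/
theorem exists_monochromatic_box {V : ℕ → Type u}
    (hV : ∀ n : ℕ, #((∀ i : Fin n, V i) → ℕ) < #(V n)) (n : ℕ) (C : (∀ i : Fin n, V i) → ℕ) :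
    ∃ a b : ∀ i : Fin n, V i, (∀ i, a i ≠ b i) ∧
      ∀ s : ∀ i : Fin n, V i, (∀ i, s i = a i ∨ s i = b i) → C s = C a := by
  induction n with
  | zero => exact ⟨fun i => i.elim0, fun i => i.elim0, fun i => i.elim0,
      fun s _ => congrArg C (funext fun i => i.elim0)⟩
  | succ n ih =>
    -- `V n` has more points than there are colourings of the first `n` factors, so two slices carry
    -- the same colouring.
    let F : V n → (∀ i : Fin n, V i) → ℕ := fun v r =>
      C (Fin.snoc (α := fun i : Fin (n + 1) => V i) r v)
    have hF : ¬ Function.Injective F := fun h =>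
      absurd (Cardinal.mk_le_of_injective h) (not_le.2 (hV n))
    obtain ⟨v, w, hvw, hne⟩ := Function.not_injective_iff.1 hF
    obtain ⟨a, b, hab, hC⟩ := ih (F v)
    refine ⟨Fin.snoc (α := fun i : Fin (n + 1) => V i) a v,
      Fin.snoc (α := fun i : Fin (n + 1) => V i) b w, ?_, ?_⟩
    · intro i
      refine Fin.lastCases ?_ (fun i => ?_) i
      · simpa using hne
      · simpa using hab i
    · intro s hs
      have h1 : F v (Fin.init s) = F v a := hC _ fun i => by
        simpa [Fin.init] using hs i.castSucc
      have h2 : C s = F (s (Fin.last n)) (Fin.init s) := by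
        simp only [F, Fin.snoc_init_self]
      have h3 : F (s (Fin.last n)) = F v := by
        have := hs (Fin.last n)
        simp only [Fin.snoc_last] at this
        rcases this with h | h
        · rw [h]
        · rw [h, hvw]
      rw [h2, h3, h1]

/-- If a map on such a product takes only countably many values on each line parallel to an axis,
then it takes the same value at two points that differ in each coordinate. -/
theorem exists_eq_of_countable_lines {V : ℕ → Type u}
    (hV : ∀ n : ℕ, #((∀ i : Fin n, V i) → ℕ) < #(V n)) {L : Type*} (n : ℕ)
    (q : (∀ i : Fin n, V i) → L)
    (hq : ∀ s i, (Set.range fun v => q (Function.update s i v)).Countable) :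
    ∃ a b : ∀ i : Fin n, V i, (∀ i, a i ≠ b i) ∧ q a = q b := by
  have hne : ∀ k, Nonempty (V k) := fun k =>
    Cardinal.mk_ne_zero_iff.1 ((zero_le).trans_lt (hV k)).ne'
  have hcol : ∀ (s : ∀ i : Fin n, V i) (i : Fin n), ∃ g : L → ℕ,
      Set.InjOn g (Set.range fun v => q (Function.update s i v)) := fun s i =>
    (Set.countable_iff_exists_injOn).1 (hq s i)
  choose g hg using hcol
  let d : ∀ i : Fin n, V i := fun i => Classical.choice (hne i)
  -- Entry `i` codes the label of `s` injectively along its line in direction `i`. Resetting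
  -- coordinate `i` to `d i` makes the code depend only on the line.
  let col : (∀ i : Fin n, V i) → Fin n → ℕ := fun s i => g (Function.update s i (d i)) i (q s)
  obtain ⟨enc, henc⟩ := exists_injective_nat (Fin n → ℕ)
  obtain ⟨a, b, hab, hC⟩ := exists_monochromatic_box hV n fun s => enc (col s)
  refine ⟨a, b, hab, ?_⟩
  have hline : ∀ (s : ∀ i : Fin n, V i) (i : Fin n) (v : V i),
      col s = col (Function.update s i v) → q s = q (Function.update s i v) := by
    intro s i v h
    have h1 := congrFun h i
    simp only [col, Function.update_idem] at h1
    refine hg (Function.update s i (d i)) i ⟨s i, ?_⟩ ⟨v, ?_⟩ h1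
    · simp
    · simp
  -- A path inside the monochromatic box from `a` to `b`, changing one coordinate at a time. Each
  -- step stays on a line with the same code, so the label never changes.
  let p : ℕ → ∀ i : Fin n, V i := fun k i => if (i : ℕ) < k then b i else a i
  have hp : ∀ k, col (p k) = col a := fun k =>
    henc (hC (p k) fun i => by by_cases h : (i : ℕ) < k <;> simp [p, h])
  have hstep : ∀ k ≤ n, q (p k) = q a := by
    intro k
    induction k with
    | zero => intro _; simp [p]
    | succ k ih =>
      intro hk
      have hupd : p (k + 1) = Function.update (p k) ⟨k, hk⟩ (b ⟨k, hk⟩) := by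
        funext i
        by_cases h : i = ⟨k, hk⟩
        · subst h; simp [p]
        · have : (i : ℕ) ≠ k := fun h' => h (Fin.ext h')
          rw [Function.update_of_ne h]
          simp only [p]
          congr 1
          exact propext (by omega)
      rw [← ih (by omega), hupd]
      exact (hline _ _ _ (by rw [← hupd, hp, hp])).symm
  rw [← hstep n le_rfl]
  congr 1
  funext i
  simp [p]

theorem beth_natCast_le_beth_omega0 (n : ℕ) : ℶ_ (n : Ordinal.{u}) ≤ ℶ_ Ordinal.omega0.{u} :=
  Cardinal.beth_le_beth.2 (Ordinal.natCast_lt_omega0 n).le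

/-- A set of cardinality at least `ℶ_ω` contains disjoint sets `V 0, V 1, …`, each much larger
than the product of the previous ones. -/
theorem exists_box_system {ι : Type u} (hι : ℶ_ Ordinal.omega0.{u} ≤ #ι) :
    ∃ V : ℕ → Type u, (∀ n : ℕ, #((∀ i : Fin n, V i) → ℕ) < #(V n)) ∧
      ∃ g : (Σ n, V n) → ι, Function.Injective g := by
  -- With `V n` of size `ℶ_(2n+2)`, the product of the earlier factors is at most `ℶ_(2n)`, so it
  -- has at most `ℶ_(2n+1)` countable colourings.
  refine ⟨fun n => (ℶ_ ((2 * n + 2 : ℕ) : Ordinal.{u})).out, fun n => ?_, ?_⟩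
  · rw [Cardinal.mk_out]
    have h1 : #(∀ i : Fin n, (ℶ_ ((2 * (i : ℕ) + 2 : ℕ) : Ordinal.{u})).out) ≤
        ℶ_ ((2 * n : ℕ) : Ordinal.{u}) := by
      have hle : ∀ i : Fin n, #(ℶ_ ((2 * (i : ℕ) + 2 : ℕ) : Ordinal.{u})).out ≤
          #(ℶ_ ((2 * n : ℕ) : Ordinal.{u})).out := fun i => by
        rw [Cardinal.mk_out, Cardinal.mk_out, Cardinal.beth_le_beth]
        exact_mod_cast (by omega : 2 * (i : ℕ) + 2 ≤ 2 * n)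
      rw [Cardinal.mk_pi]
      refine (Cardinal.prod_le_prod _ _ hle).trans ?_
      rw [Cardinal.prod_const, Cardinal.mk_out]
      simp only [Cardinal.mk_fin, Cardinal.lift_natCast, Cardinal.lift_uzero]
      exact Cardinal.power_nat_le (Cardinal.aleph0_le_beth _)
    calc #((∀ i : Fin n, (ℶ_ ((2 * (i : ℕ) + 2 : ℕ) : Ordinal.{u})).out) → ℕ)
        = ℵ₀ ^ #(∀ i : Fin n, (ℶ_ ((2 * (i : ℕ) + 2 : ℕ) : Ordinal.{u})).out) := by simp
      _ ≤ ℵ₀ ^ ℶ_ ((2 * n : ℕ) : Ordinal.{u}) :=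
          Cardinal.power_le_power_left Cardinal.aleph0_ne_zero h1
      _ = 2 ^ ℶ_ ((2 * n : ℕ) : Ordinal.{u}) :=
          Cardinal.power_eq_two_power (Cardinal.aleph0_le_beth _)
            (Cardinal.natCast_lt_aleph0 (n := 2)).le (Cardinal.aleph0_le_beth _)
      _ = ℶ_ ((2 * n : ℕ) + 1 : Ordinal.{u}) := (Cardinal.beth_add_one _).symm
      _ < ℶ_ ((2 * n + 2 : ℕ) : Ordinal.{u}) := by
          rw [Cardinal.beth_lt_beth]
          exact_mod_cast (by omega : 2 * n + 1 < 2 * n + 2)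
  · have : #(Σ n : ℕ, (ℶ_ ((2 * n + 2 : ℕ) : Ordinal.{u})).out) ≤ #ι := by
      refine le_trans ?_ hι
      rw [Cardinal.mk_sigma]
      refine (Cardinal.sum_le_lift_mk_mul_iSup_lift _).trans ?_
      refine Cardinal.mul_le_of_le (Cardinal.aleph0_le_beth _) ?_ ?_
      · simpa using Cardinal.aleph0_le_beth _
      · refine ciSup_le' fun n => ?_
        simpa using beth_natCast_le_beth_omega0 (2 * n + 2)
    obtain ⟨g⟩ := this
    exact ⟨g, g.injective⟩

end Boxes

/-! ### Symmetric families and their coordinate functionals -/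

section SymmetricFamilies

/-- The norm of a linear combination of members of the family `e` with distinct indices depends
only on the coefficients. -/
def IsSymmetricFamily {X : Type*} [NormedAddCommGroup X] [NormedSpace ℝ X] {ι : Type*}
    (e : ι → X) : Prop :=
  ∀ (n : ℕ) (a : Fin n → ℝ) (γ β : Fin n → ι), Function.Injective γ → Function.Injective β →
    ‖∑ i, a i • e (γ i)‖ = ‖∑ i, a i • e (β i)‖

variable {X : Type*} [NormedAddCommGroup X] [NormedSpace ℝ X] {ι : Type*} {e : ι → X}

namespace IsSymmetricFamily

theorem norm_sum_eq (h : IsSymmetricFamily e) {J : Type*} [Fintype J] (c : J → ℝ) {g k : J → ι}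
    (hg : Function.Injective g) (hk : Function.Injective k) :
    ‖∑ j, c j • e (g j)‖ = ‖∑ j, c j • e (k j)‖ := by
  let E := Fintype.equivFin J
  rw [← E.symm.sum_comp, ← E.symm.sum_comp fun j => c j • e (k j)]
  exact h _ (fun i => c (E.symm i)) (fun i => g (E.symm i)) (fun i => k (E.symm i))
    (hg.comp E.symm.injective) (hk.comp E.symm.injective)

theorem comp (h : IsSymmetricFamily e) {κ : Type*} {g : κ → ι} (hg : Function.Injective g) :
    IsSymmetricFamily (e ∘ g) :=
  fun n a γ β hγ hβ => h n a (g ∘ γ) (g ∘ β) (hg.comp hγ) (hg.comp hβ)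

theorem norm_eq (h : IsSymmetricFamily e) (i j : ι) : ‖e i‖ = ‖e j‖ := by
  simpa using h 1 (fun _ => 1) (fun _ => i) (fun _ => j) (Function.injective_of_subsingleton _)
    (Function.injective_of_subsingleton _)

theorem norm_sub_eq (h : IsSymmetricFamily e) {i j i' j' : ι} (hij : i ≠ j) (hij' : i' ≠ j') :
    ‖e i - e j‖ = ‖e i' - e j'‖ := by
  have := h 2 ![1, -1] ![i, j] ![i', j']
    (by intro a b; fin_cases a <;> fin_cases b <;> simp [hij, hij.symm])
    (by intro a b; fin_cases a <;> fin_cases b <;> simp [hij', hij'.symm])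
  simpa [Fin.sum_univ_two, sub_eq_add_neg] using this

/-- Coefficients of finite linear combinations are controlled by the norm. -/
theorem abs_coeff_mul_le [Infinite ι] (h : IsSymmetricFamily e) {i₀ i₁ : ι} (h01 : i₀ ≠ i₁)
    (s : Finset ι) (c : ι → ℝ) {j : ι} (hj : j ∈ s) :
    |c j| * ‖e i₀ - e i₁‖ ≤ 2 * ‖∑ i ∈ s, c i • e i‖ := by
  classical
  -- Swapping `j` with an unused index `j'` preserves the norm, and the difference of the two sums
  -- is `c j • (e j - e j')`.
  obtain ⟨j', hj'⟩ := Infinite.exists_notMem_finset s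
  have hne : j ≠ j' := fun h => hj' (h ▸ hj)
  have h1 := h.norm_sum_eq (fun i : s => c i) (g := fun i : s => (i : ι))
    (k := fun i : s => Equiv.swap j j' i) Subtype.val_injective
    ((Equiv.injective _).comp Subtype.val_injective)
  rw [Finset.sum_coe_sort s fun i => c i • e i,
    Finset.sum_coe_sort s fun i => c i • e (Equiv.swap j j' i)] at h1
  have h2 : ∑ i ∈ s, c i • e i - ∑ i ∈ s, c i • e (Equiv.swap j j' i) = c j • (e j - e j') := by
    rw [← Finset.sum_sub_distrib, Finset.sum_eq_single_of_mem j hj]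
    · simp [smul_sub]
    · intro i hi hij
      rw [Equiv.swap_apply_of_ne_of_ne hij (by rintro rfl; exact hj' hi), sub_self]
  calc |c j| * ‖e i₀ - e i₁‖ = ‖c j • (e j - e j')‖ := by
        rw [norm_smul, Real.norm_eq_abs, h.norm_sub_eq h01 hne]
    _ ≤ _ := by rw [← h2, two_mul]; exact (norm_sub_le _ _).trans (by rw [← h1])

theorem linearIndependent [Infinite ι] (h : IsSymmetricFamily e) (he : Function.Injective e) :
    LinearIndependent ℝ e := by
  rw [linearIndependent_iff']
  intro s c hc j hj
  obtain ⟨i₁, h01⟩ := exists_ne j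
  have := h.abs_coeff_mul_le h01.symm s c hj
  rw [hc, norm_zero, mul_zero] at this
  have hd : 0 < ‖e j - e i₁‖ := norm_pos_iff.2 (sub_ne_zero.2 (he.ne h01.symm))
  have h0 : |c j| ≤ 0 := by
    by_contra! hlt
    exact absurd this (not_le.2 (mul_pos hlt hd))
  exact abs_nonpos_iff.1 h0

/-- The coordinate functionals of a symmetric family are continuous. -/
theorem exists_coord [Infinite ι] (h : IsSymmetricFamily e) (he : Function.Injective e) (j : ι) :
    ∃ φ : StrongDual ℝ X, φ (e j) = 1 ∧ ∀ i ≠ j, φ (e i) = 0 := by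
  classical
  have hli := h.linearIndependent he
  obtain ⟨i₁, h01⟩ := exists_ne j
  have hd : 0 < ‖e j - e i₁‖ := norm_pos_iff.2 (sub_ne_zero.2 (he.ne h01.symm))
  -- The algebraic coordinate on the span is bounded by the coefficient estimate, so Hahn–Banach
  -- extends it.
  let ψ : Submodule.span ℝ (Set.range e) →ₗ[ℝ] ℝ := (Finsupp.lapply j).comp hli.repr
  have hb : ∀ x, ‖ψ x‖ ≤ 2 / ‖e j - e i₁‖ * ‖x‖ := by
    intro x
    rw [div_mul_eq_mul_div, le_div_iff₀ hd, Real.norm_eq_abs]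
    change |hli.repr x j| * _ ≤ _
    by_cases hj : j ∈ (hli.repr x).support
    · have h1 := h.abs_coeff_mul_le h01.symm _ (hli.repr x) hj
      have h2 := hli.linearCombination_repr x
      rw [Finsupp.linearCombination_apply, Finsupp.sum] at h2
      rwa [h2] at h1
    · rw [Finsupp.notMem_support_iff.1 hj]
      simp
  obtain ⟨φ, hφ, -⟩ := exists_extension_norm_eq _ (ψ.mkContinuous _ hb)
  have hval : ∀ i, φ (e i) = (Finsupp.single i (1 : ℝ)) j := fun i => by
    have h1 := hφ ⟨e i, Submodule.subset_span ⟨i, rfl⟩⟩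
    rw [h1, LinearMap.mkContinuous_apply]
    change hli.repr _ j = _
    rw [hli.repr_eq_single i _ rfl]
  refine ⟨φ, by rw [hval]; simp, fun i hi => by rw [hval]; simp [hi]⟩

end IsSymmetricFamily

end SymmetricFamilies

/-! ### Bounded sums of differences -/

section Embedding

variable {X : Type*} [NormedAddCommGroup X] [NormedSpace ℝ X] {ι : Type u} {e : ι → X}

/-- If the ambient space coarsely or uniformly embeds into some `c₀(Γ)`, then sums of differences
of members of a symmetric family of size at least `ℶ_ω` are uniformly bounded. -/
theorem IsSymmetricFamily.exists_norm_sum_sub_le (h : IsSymmetricFamily e)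
    (hι : ℶ_ Ordinal.omega0.{u} ≤ #ι) {Γ : Type v} {f : X → c0Space Γ}
    (hf : IsCoarseEmb f ∨ IsUniformEmb f) :
    ∃ K : ℝ, ∀ (n : ℕ) (c : Fin n → ℝ), (∀ i, |c i| ≤ 1) → ∀ a b : Fin n → ι,
      Function.Injective (Sum.elim a b) → ‖∑ i, c i • (e (a i) - e (b i))‖ ≤ K := by
  obtain ⟨t, M, D, ht, hM, hfM, hfD⟩ := exists_scale_of_isCoarseEmb_or_isUniformEmb hf
  obtain ⟨V, hV, g, hg⟩ := exists_box_system hι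
  have hne : Nonempty ι := Cardinal.mk_ne_zero_iff.1
    ((Cardinal.beth_pos _).trans_le hι).ne'
  obtain ⟨i₀⟩ := hne
  -- Changing one index moves the point by at most `τ * (2 * ‖e i₀‖)`; the `+ 1` keeps the
  -- denominator positive.
  set τ : ℝ := t / (2 * ‖e i₀‖ + 1) with hτ
  have hτ0 : 0 < τ := by positivity
  have hτt : τ * (2 * ‖e i₀‖) ≤ t := by
    rw [hτ, div_mul_eq_mul_div, div_le_iff₀ (by positivity)]
    nlinarith
  refine ⟨D / τ, fun n c hc a b hab => ?_⟩
  let x : (∀ i : Fin n, V i) → X := fun s => ∑ i, (τ * c i) • e (g ⟨i, s i⟩)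
  have hnear : ∀ s i v, dist (x (Function.update s i v)) (x s) ≤ t := by
    intro s i v
    have h1 : x (Function.update s i v) - x s = (τ * c i) • (e (g ⟨i, v⟩) - e (g ⟨i, s i⟩)) := by
      simp only [x]
      rw [← Finset.sum_sub_distrib, Finset.sum_eq_single_of_mem i (Finset.mem_univ i)]
      · simp [smul_sub]
      · intro j _ hj
        rw [Function.update_of_ne hj, sub_self]
    rw [dist_eq_norm, h1, norm_smul, Real.norm_eq_abs, abs_mul, abs_of_pos hτ0]
    have h2 : ‖e (g ⟨i, v⟩) - e (g ⟨i, s i⟩)‖ ≤ 2 * ‖e i₀‖ :=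
      (norm_sub_le _ _).trans 
      (by rw [h.norm_eq _ i₀, h.norm_eq (g ⟨i, s i⟩) i₀, two_mul])
    calc τ * |c i| * ‖e (g ⟨i, v⟩) - e (g ⟨i, s i⟩)‖ ≤ τ * 1 * (2 * ‖e i₀‖) := by
          gcongr; exact hc i
      _ ≤ t := by rwa [mul_one]
  obtain ⟨p, r, hpr, hq⟩ := exists_eq_of_countable_lines hV n
    (fun s => roundLabel M (f (x s)).1) fun s i =>
      (countable_roundLabel_image hM (f (x s))).mono (by
        rintro _ ⟨v, rfl⟩
        exact ⟨_, hfM _ _ (hnear s i v), rfl⟩)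
  have hD : dist (x p) (x r) ≤ D := hfD _ _ (dist_le_of_roundLabel_eq hM hq)
  have hinj : Function.Injective
      (Sum.elim (fun i : Fin n => g ⟨i, p i⟩) fun i : Fin n => g ⟨i, r i⟩) := by
    rintro (i | i) (j | j) hij
    · have := hg hij
      simp only [Sigma.mk.injEq] at this
      rw [Fin.ext this.1]
    · have := hg hij
      simp only [Sigma.mk.injEq] at this
      obtain rfl := Fin.ext this.1
      exact absurd (eq_of_heq this.2) (hpr i)
    · have := hg hij
      simp only [Sigma.mk.injEq] at this
      obtain rfl := Fin.ext this.1
      exact absurd (eq_of_heq this.2).symm (hpr i)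
    · have := hg hij
      simp only [Sigma.mk.injEq] at this
      rw [Fin.ext this.1]
  have hdiff : x p - x r = τ • ∑ i, c i • (e (g ⟨i, p i⟩) - e (g ⟨i, r i⟩)) := by
    simp only [x]
    rw [← Finset.sum_sub_distrib, Finset.smul_sum]
    refine Finset.sum_congr rfl fun i _ => ?_
    rw [← smul_sub, mul_smul]
  -- Written as one combination over `2n` distinct indices, the sum for `p`, `r` has the same norm
  -- as the sum for arbitrary `a`, `b`.
  have hsum : ∀ a b : Fin n → ι, ∑ i, c i • (e (a i) - e (b i)) =
      ∑ j : Fin n ⊕ Fin n, Sum.elim c (fun i => -c i) j • e (Sum.elim a b j) := fun a b => by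
    simp only [Fintype.sum_sum_type, smul_sub, Finset.sum_sub_distrib, Sum.elim_inl, Sum.elim_inr,
      neg_smul, Finset.sum_neg_distrib, ← sub_eq_add_neg]
  rw [dist_eq_norm, hdiff, norm_smul, Real.norm_eq_abs, abs_of_pos hτ0] at hD
  rw [le_div_iff₀' hτ0, hsum, h.norm_sum_eq _ hab hinj, ← hsum]
  exact hD

end Embedding

/-! ### Transfinite sums and long Schauder bases -/

section TransfiniteSums

/-- Transfinite induction for partial sums of a transfinite series: closed conditions that are
preserved at successor steps propagate. -/
theorem ContinuousOn.mem_of_succ_mem {Y : Type*} [TopologicalSpace Y] {o : Ordinal.{v}}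
    {S : Ordinal.{v} → Y} (hS : ContinuousOn S (Set.Iic o)) {C : Set Y} (hC : IsClosed C)
    {α₀ : Ordinal.{v}} (h0 : S α₀ ∈ C)
    (hstep : ∀ γ, α₀ ≤ γ → γ < o → S γ ∈ C → S (Order.succ γ) ∈ C) {α : Ordinal.{v}}
    (hα₀ : α₀ ≤ α) (hα : α ≤ o) : S α ∈ C := by
  induction α using WellFoundedLT.induction with
  | ind α ih =>
    rcases hα₀.eq_or_lt with rfl | hlt
    · exact h0
    by_cases hlim : Order.IsSuccPrelimit α
    · have hlub : IsLUB (Set.Ico α₀ α) α := by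
        refine ⟨fun x hx => hx.2.le, fun b hb => ?_⟩
        by_contra! hbα
        have h1 : Order.succ (max α₀ b) < α := hlim.succ_lt (max_lt hlt hbα)
        have h2 := hb ⟨(le_max_left α₀ b).trans (Order.le_succ _), h1⟩
        exact absurd ((Order.lt_succ (max α₀ b)).trans_le h2) (not_lt.2 (le_max_right _ _))
      have hcl : α ∈ closure (Set.Ico α₀ α) := hlub.mem_closure ⟨α₀, le_rfl, hlt⟩
      have hcont : ContinuousWithinAt S (Set.Ico α₀ α) α :=
        (hS α hα).mono fun x hx => hx.2.le.trans hα
      have := hcont.mem_closure hcl (t := C) fun x hx => ih x hx.2 hx.1 (hx.2.le.trans hα)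
      rwa [hC.closure_eq] at this
    · obtain ⟨β, hβα⟩ := not_forall_not.1 hlim
      obtain rfl : Order.succ β = α := hβα.succ_eq
      have hβ : β < Order.succ β := Order.lt_succ β
      have hβ0 : α₀ ≤ β := Order.lt_succ_iff.1 hlt
      exact hstep β hβ0 (hβ.trans_le hα) (ih β hβ hβ0 (hβ.le.trans hα))

variable {X : Type u} [NormedAddCommGroup X]

theorem HasTransfiniteSum.mem_of_isClosed {o : Ordinal.{v}} {x : Set.Iio o → X} {s : X}
    (h : HasTransfiniteSum x s) {C : Set X} (hC : IsClosed C) (h0 : 0 ∈ C)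
    (hstep : ∀ γ, ∀ y ∈ C, y + x γ ∈ C) : s ∈ C := by
  obtain ⟨S, hS, hS0, hsucc, rfl⟩ := h
  refine hS.mem_of_succ_mem hC (α₀ := 0) (by rwa [hS0]) (fun γ _ hγ hmem => ?_) (zero_le) le_rfl
  rw [hsucc ⟨γ, hγ⟩]
  exact hstep _ _ hmem

/-- Along the partial sums `φ` is zero up to stage `j`, jumps there by `φ (x j)`, and is constant
afterwards. -/
theorem HasTransfiniteSum.map_eq_of_map_eq_zero [NormedSpace ℝ X] {o : Ordinal.{v}}
    {x : Set.Iio o → X} {s : X} (h : HasTransfiniteSum x s) (φ : StrongDual ℝ X) (j : Set.Iio o)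
    (hφ : ∀ i ≠ j, φ (x i) = 0) : φ s = φ (x j) := by
  obtain ⟨S, hS, hS0, hsucc, rfl⟩ := h
  have hj : (j : Ordinal) < o := j.2
  have h1 : S j ∈ {y | φ y = 0} := by
    refine (hS.mono (Set.Iic_subset_Iic.2 hj.le)).mem_of_succ_mem
      (isClosed_eq φ.continuous continuous_const) (α₀ := 0) (by simp [hS0])
      (fun γ _ hγ hmem => ?_) (zero_le) le_rfl
    have hne : (⟨γ, hγ.trans hj⟩ : Set.Iio o) ≠ j := fun h => hγ.ne (congrArg Subtype.val h)
    have hm : φ (S γ) = 0 := hmem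
    change φ (S (Order.succ γ)) = 0
    rw [hsucc ⟨γ, hγ.trans hj⟩, map_add, hφ _ hne, add_zero]
    exact hm
  have h2 : S o ∈ {y | φ y = φ (x j)} := by
    refine hS.mem_of_succ_mem
      (isClosed_eq φ.continuous continuous_const) (α₀ := Order.succ j) ?_
      (fun γ hγj hγ hmem => ?_) (Order.succ_le_of_lt hj) le_rfl
    · change φ (S (Order.succ j)) = φ (x j)
      have hm : φ (S j) = 0 := h1
      rw [hsucc j, map_add, hm, zero_add]
    · have hne : (⟨γ, hγ⟩ : Set.Iio o) ≠ j := fun h =>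
        (Order.succ_le_iff.1 hγj).ne' (congrArg Subtype.val h)
      have hm : φ (S γ) = φ (x j) := hmem
      change φ (S (Order.succ γ)) = φ (x j)
      rw [hsucc ⟨γ, hγ⟩, map_add, hφ _ hne, add_zero]
      exact hm
  exact h2

theorem hasTransfiniteSum_single {o : Ordinal.{v}} (j : Set.Iio o) (x : Set.Iio o → X)
    (hx : ∀ i ≠ j, x i = 0) : HasTransfiniteSum x (x j) := by
  classical
  refine ⟨fun α => if Order.succ (j : Ordinal) ≤ α then x j else 0, ?_, ?_, ?_, ?_⟩
  · have hcl : IsClopen (Set.Ici (Order.succ (j : Ordinal))) := by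
      refine ⟨isClosed_Ici, ?_⟩
      rw [Order.Ici_succ]
      exact isOpen_Ioi
    refine Continuous.continuousOn (continuous_const.if (fun a ha => ?_) continuous_const)
    have : a ∈ frontier (Set.Ici (Order.succ (j : Ordinal))) := ha
    rw [hcl.frontier_eq] at this
    exact this.elim
  · simp
  · intro γ
    beta_reduce
    rcases lt_trichotomy γ j with h | rfl | h
    · have h' : (γ : Ordinal) < j := h
      rw [if_neg (by simpa using h'), if_neg (by simpa using h'.le), hx γ h.ne, add_zero]
    · rw [if_pos le_rfl, if_neg (by simp), zero_add]
    · have h' : (j : Ordinal) < γ := h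
      rw [if_pos (Order.succ_le_succ h'.le), if_pos (Order.succ_le_of_lt h'), hx γ h.ne', add_zero]
  · exact if_pos (Order.succ_le_of_lt j.2)

variable [NormedSpace ℝ X]

theorem IsLongSchauderBasis.injective {o : Ordinal.{v}} {e : Set.Iio o → X}
    (he : IsLongSchauderBasis e) : Function.Injective e := by
  classical
  intro i j hij
  by_contra hne
  have hsum : ∀ k, HasTransfiniteSum (fun γ => (Pi.single k 1 : Set.Iio o → ℝ) γ • e γ) (e k) :=
    fun k => by
      simpa using hasTransfiniteSum_single k
        (fun γ => (Pi.single k 1 : Set.Iio o → ℝ) γ • e γ) fun i hi => by simp [hi]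
  have h1 := (he (e i)).unique (hsum i) (by rw [hij]; exact hsum j)
  have h2 := congrFun h1 i
  simp [hne] at h2

theorem IsLongSchauderBasis.span_closure_eq_top {o : Ordinal.{v}} {e : Set.Iio o → X}
    (he : IsLongSchauderBasis e) : (Submodule.span ℝ (Set.range e)).topologicalClosure = ⊤ := by
  rw [eq_top_iff]
  intro x _
  obtain ⟨a, ha, -⟩ := he x
  refine ha.mem_of_isClosed (Submodule.isClosed_topologicalClosure _) (Submodule.zero_mem _)
    fun γ y hy => Submodule.add_mem _ hy (Submodule.le_topologicalClosure _
      (Submodule.smul_mem _ _ (Submodule.subset_span ⟨γ, rfl⟩)))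

/-- Density of the span would not suffice: the vectors `(1, uₙ)` in `ℝ ⊕ c₀`, with `uₙ` the unit
vectors, form a symmetric family with dense span, but every coordinate functional kills `(1, 0)`. -/
theorem IsLongSchauderBasis.eq_zero_of_coord_eq_zero {o : Ordinal.{v}} {e : Set.Iio o → X}
    (he : IsLongSchauderBasis e) {φ : Set.Iio o → StrongDual ℝ X} (hφ : ∀ j, φ j (e j) = 1)
    (hφ' : ∀ j, ∀ i ≠ j, φ j (e i) = 0) {z : X} (hz : ∀ j, φ j z = 0) : z = 0 := by
  obtain ⟨a, ha, -⟩ := he z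
  have ha0 : ∀ j, a j = 0 := fun j => by
    have := ha.map_eq_of_map_eq_zero (φ j) j fun i hi => by simp [hφ' j i hi]
    simpa [hz, hφ] using this.symm
  exact ha.mem_of_isClosed isClosed_singleton rfl fun γ y hy => by
    rw [Set.mem_singleton_iff.1 hy, ha0, zero_smul, add_zero]
    rfl

end TransfiniteSums

/-! ### The upper `c₀` estimate -/

section UpperEstimate

variable {X : Type*} [NormedAddCommGroup X] [NormedSpace ℝ X] {ι : Type*} {e : ι → X}

/-- If sums of differences are uniformly bounded and only zero is annihilated by all coordinate
functionals, then averages of members of a symmetric family are eventually small. -/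
theorem IsSymmetricFamily.tendsto_average [CompleteSpace X] {K : ℝ}
    (hK : ∀ (n : ℕ) (c : Fin n → ℝ), (∀ i, |c i| ≤ 1) → ∀ a b : Fin n → ι,
      Function.Injective (Sum.elim a b) → ‖∑ i, c i • (e (a i) - e (b i))‖ ≤ K)
    {φ : ι → StrongDual ℝ X} (hφ : ∀ j, φ j (e j) = 1) (hφ' : ∀ j, ∀ i ≠ j, φ j (e i) = 0)
    (hz : ∀ z, (∀ j, φ j z = 0) → z = 0) (p : ℕ ↪ ι) :
    Tendsto (fun k : ℕ => ((2 : ℝ) ^ k)⁻¹ • ∑ m ∈ Finset.range (2 ^ k), e (p m)) atTop (𝓝 0) := by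
  classical
  set w : ℕ → X := fun k => ((2 : ℝ) ^ k)⁻¹ • ∑ m ∈ Finset.range (2 ^ k), e (p m) with hw
  have hcauchy : CauchySeq w := by
    refine cauchySeq_of_le_geometric_two (C := K) fun k => ?_
    -- Pairing the first half of the longer block with the second half leaves `2 ^ k` differences,
    -- whose sum has norm at most `K`.
    have h1 : w k - w (k + 1) = ((2 : ℝ) ^ (k + 1))⁻¹ •
        ∑ i : Fin (2 ^ k), (1 : ℝ) • (e (p i) - e (p (2 ^ k + i))) := by
      simp only [hw, one_smul]
      rw [Fin.sum_univ_eq_sum_range (fun m => e (p m) - e (p (2 ^ k + m))),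
        Finset.sum_sub_distrib, pow_succ (2 : ℕ) k, mul_two ((2 : ℕ) ^ k), Finset.sum_range_add,
        pow_succ (2 : ℝ) k, mul_inv]
      module
    have h2 := hK (2 ^ k) (fun _ => 1) (fun _ => by simp) (fun i => p i) (fun i => p (2 ^ k + i))
      (by
        rintro (i | i) (j | j) hij
        · rw [Fin.ext (p.injective hij)]
        · have h := p.injective hij
          have := i.2
          omega
        · have h := p.injective hij
          have := j.2
          omega
        · rw [Fin.ext (add_left_cancel (p.injective hij))])
    rw [dist_eq_norm, h1, norm_smul, norm_inv, norm_pow, Real.norm_ofNat, pow_succ', mul_inv,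
      div_div, div_eq_inv_mul, mul_inv]
    gcongr
  obtain ⟨z, hwz⟩ := cauchySeq_tendsto_of_complete hcauchy
  have hz0 : z = 0 := by
    refine hz z fun j => ?_
    have h1 : Tendsto (fun k => φ j (w k)) atTop (𝓝 (φ j z)) :=
      ((φ j).continuous.tendsto z).comp hwz
    refine tendsto_nhds_unique h1 ?_
    have h2 : Tendsto (fun k : ℕ => ((1 / 2 : ℝ)) ^ k) atTop (𝓝 0) :=
      tendsto_pow_atTop_nhds_zero_of_lt_one (by norm_num) (by norm_num)
    refine squeeze_zero_norm (fun k => ?_) h2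
    have h3 : ∀ m, φ j (e (p m)) = if p m = j then 1 else 0 := fun m => by
      by_cases h : p m = j
      · rw [if_pos h, h, hφ]
      · rw [if_neg h, hφ' j _ h]
    simp only [hw, map_smul, map_sum, h3, Finset.sum_boole]
    have h4 : ((Finset.range (2 ^ k)).filter fun m => p m = j).card ≤ 1 := by
      rw [Finset.card_le_one]
      intro a ha b hb
      exact p.injective ((Finset.mem_filter.1 ha).2.trans (Finset.mem_filter.1 hb).2.symm)
    rw [norm_smul, norm_inv, norm_pow, Real.norm_ofNat, one_div, inv_pow, Real.norm_natCast]
    exact mul_le_of_le_one_right (by positivity) (by exact_mod_cast h4)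
  rwa [hz0] at hwz

theorem IsSymmetricFamily.norm_sum_le [CompleteSpace X] [Infinite ι] (h : IsSymmetricFamily e)
    {K : ℝ} (hK : ∀ (n : ℕ) (c : Fin n → ℝ), (∀ i, |c i| ≤ 1) → ∀ a b : Fin n → ι,
      Function.Injective (Sum.elim a b) → ‖∑ i, c i • (e (a i) - e (b i))‖ ≤ K)
    {φ : ι → StrongDual ℝ X} (hφ : ∀ j, φ j (e j) = 1) (hφ' : ∀ j, ∀ i ≠ j, φ j (e i) = 0)
    (hz : ∀ z, (∀ j, φ j z = 0) → z = 0) (n : ℕ) (c : Fin n → ℝ) (hc : ∀ i, |c i| ≤ 1)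
    (a : Fin n → ι) (ha : Function.Injective a) : ‖∑ i, c i • e (a i)‖ ≤ K := by
  classical
  let p : ℕ ↪ ι := Infinite.natEmbedding ι
  have hw := (IsSymmetricFamily.tendsto_average hK hφ hφ' hz p).norm
  rw [norm_zero] at hw
  have : Infinite ((Set.range a)ᶜ : Set ι) := (Set.finite_range a).infinite_compl.to_subtype
  let q : ℕ ↪ ((Set.range a)ᶜ : Set ι) := Infinite.natEmbedding _
  -- Pairwise disjoint infinite blocks of indices, one for each `i`, all avoiding the range of `a`.
  let B : Fin n → ℕ → ι := fun i m => q (Encodable.encode (i, m))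
  have hB : ∀ i j m l, B i m = B j l → i = j ∧ m = l := fun i j m l hij =>
    Prod.ext_iff.1 (Encodable.encode_injective (q.injective (Subtype.ext hij)))
  have hBa : ∀ i m j, B i m ≠ a j := fun i m j hij => (q (Encodable.encode (i, m))).2 ⟨j, hij.symm⟩
  have hbound : ∀ k : ℕ, ‖∑ i, c i • e (a i)‖ ≤
      K + n * ‖((2 : ℝ) ^ k)⁻¹ • ∑ m ∈ Finset.range (2 ^ k), e (p m)‖ := by
    intro k
    set r : ℝ := ((2 : ℝ) ^ k)⁻¹ with hr
    have hr0 : 0 < r := by positivity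
    have hr1 : r * 2 ^ k = 1 := by rw [hr]; field_simp
    have h1 : ‖r • ∑ m ∈ Finset.range (2 ^ k), ∑ i, c i • (e (a i) - e (B i m))‖ ≤ K := by
      rw [norm_smul, Real.norm_eq_abs, abs_of_pos hr0]
      have h2 : ‖∑ m ∈ Finset.range (2 ^ k), ∑ i, c i • (e (a i) - e (B i m))‖ ≤
          ∑ m ∈ Finset.range (2 ^ k), K := norm_sum_le_of_le _ fun m _ => by
        refine hK n c hc a (fun i => B i m) ?_
        rintro (i | i) (j | j) hij
        · rw [ha hij]
        · exact absurd hij.symm (hBa _ _ _)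
        · exact absurd hij (hBa _ _ _)
        · rw [(hB _ _ _ _ hij).1]
      rw [Finset.sum_const, Finset.card_range, nsmul_eq_mul] at h2
      push_cast at h2
      calc _ ≤ r * (2 ^ k * K) := by gcongr
        _ = K := by rw [← mul_assoc, hr1, one_mul]
    -- Averaging over `m` leaves `e (a i)` intact and replaces `e (B i m)` by a block average, which
    -- is small in norm for large `k`.
    have h3 : ∑ i, c i • e (a i) = r • ∑ m ∈ Finset.range (2 ^ k), ∑ i, c i • (e (a i) - e (B i m))
        + ∑ i, c i • r • ∑ m ∈ Finset.range (2 ^ k), e (B i m) := by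
      rw [Finset.sum_comm, Finset.smul_sum, ← Finset.sum_add_distrib]
      refine Finset.sum_congr rfl fun i _ => ?_
      rw [← Finset.smul_sum, Finset.sum_sub_distrib, Finset.sum_const, Finset.card_range,
        smul_comm r (c i), ← smul_add, smul_sub, sub_add_cancel, ← Nat.cast_smul_eq_nsmul ℝ]
      push_cast
      rw [smul_smul r, hr1, one_smul]
    have h4 : ∀ i, ‖r • ∑ m ∈ Finset.range (2 ^ k), e (B i m)‖ =
        ‖r • ∑ m ∈ Finset.range (2 ^ k), e (p m)‖ := fun i => by
      have := h.norm_sum_eq (fun _ : Fin (2 ^ k) => (1 : ℝ)) (g := fun m => B i m)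
        (k := fun m => p m) (fun m l hml => Fin.ext (hB _ _ _ _ hml).2)
        (fun m l hml => Fin.ext (p.injective hml))
      simp only [one_smul] at this
      rw [Fin.sum_univ_eq_sum_range (fun m => e (B i m)),
        Fin.sum_univ_eq_sum_range (fun m => e (p m))] at this
      rw [norm_smul, norm_smul, this]
    rw [h3]
    refine (norm_add_le _ _).trans (add_le_add h1 ?_)
    refine (norm_sum_le_of_le _ (f := fun i => c i • r • ∑ m ∈ Finset.range (2 ^ k), e (B i m))
      (n := fun _ => ‖r • ∑ m ∈ Finset.range (2 ^ k), e (p m)‖) fun i _ => ?_).trans ?_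
    · rw [norm_smul, h4, Real.norm_eq_abs]
      exact mul_le_of_le_one_left (norm_nonneg _) (hc i)
    · simp
  refine ge_of_tendsto' (x := atTop) (b := ‖∑ i, c i • e (a i)‖) ?_ hbound
  simpa using (hw.const_mul (n : ℝ)).const_add K

theorem norm_sum_finset_le {K : ℝ} (hK : ∀ (n : ℕ) (c : Fin n → ℝ), (∀ i, |c i| ≤ 1) →
      ∀ a : Fin n → ι, Function.Injective a → ‖∑ i, c i • e (a i)‖ ≤ K)
    (s : Finset ι) (c : ι → ℝ) {r : ℝ} (hr : 0 ≤ r) (hc : ∀ i ∈ s, |c i| ≤ r) :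
    ‖∑ i ∈ s, c i • e i‖ ≤ K * r := by
  rcases hr.eq_or_lt with rfl | hr0
  · rw [Finset.sum_eq_zero fun i hi => by rw [abs_nonpos_iff.1 (hc i hi), zero_smul]]
    simp
  · let E := s.equivFin
    have h1 := hK s.card (fun i => r⁻¹ * c (E.symm i)) (fun i => by
      rw [abs_mul, abs_inv, abs_of_pos hr0, inv_mul_le_one₀ hr0]
      exact hc _ (E.symm i).2) (fun i => (E.symm i : ι))
      (Subtype.val_injective.comp E.symm.injective)
    rw [E.symm.sum_comp (fun i : s => (r⁻¹ * c i) • e (i : ι)),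
      Finset.sum_coe_sort s fun i => (r⁻¹ * c i) • e i] at h1
    simp only [mul_smul] at h1
    rw [← Finset.smul_sum, norm_smul, norm_inv, Real.norm_eq_abs, abs_of_pos hr0,
      inv_mul_le_iff₀ hr0] at h1
    linarith

end UpperEstimate

/-! ### From two-sided estimates to an isomorphism with `c₀` -/

section Isomorphism

theorem isClosed_c0Space (Γ : Type v) : IsClosed (c0Space Γ : Set (lp (fun _ : Γ => ℝ) ∞)) := by
  rw [← closure_subset_iff_isClosed]
  intro y hy
  change Tendsto (fun γ => y γ) cofinite (𝓝 0)
  rw [Metric.tendsto_nhds]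
  intro ε hε
  obtain ⟨z, hz, hyz⟩ := Metric.mem_closure_iff.1 hy (ε / 2) (by positivity)
  have h1 : Tendsto (fun γ => z γ) cofinite (𝓝 0) := hz
  filter_upwards [Metric.tendsto_nhds.1 h1 (ε / 2) (by positivity)] with γ hγ
  have h2 : ‖y γ - z γ‖ ≤ ‖y - z‖ := lp.norm_apply_le_norm ENNReal.top_ne_zero (y - z) γ
  rw [dist_eq_norm] at hyz
  rw [dist_zero_right] at hγ ⊢
  have h3 := norm_sub_norm_le (y γ) (z γ)
  linarith

instance instCompleteSpaceC0Space (Γ : Type v) : CompleteSpace (c0Space Γ) :=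
  (isClosed_c0Space Γ).completeSpace_coe

variable {X : Type*} [NormedAddCommGroup X] [NormedSpace ℝ X] {κ : Type v}

theorem summable_smul_of_c0Space [CompleteSpace X] {e : κ → X} {K : ℝ}
    (hup : ∀ (s : Finset κ) (c : κ → ℝ) (r : ℝ), 0 ≤ r → (∀ i ∈ s, |c i| ≤ r) →
      ‖∑ i ∈ s, c i • e i‖ ≤ K * r) (y : c0Space κ) : Summable fun i => y.1 i • e i := by
  rw [summable_iff_vanishing_norm]
  intro ε hε
  have hr : 0 < ε / (2 * (|K| + 1)) := by positivity
  refine ⟨(c0Space_finite_le_abs y hr).toFinset, fun t ht => ?_⟩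
  refine (hup t (fun i => y.1 i) _ hr.le fun i hi => ?_).trans_lt ?_
  · by_contra! hlt
    exact Finset.disjoint_left.1 ht hi ((Set.Finite.mem_toFinset _).2 hlt.le)
  · rw [← mul_div_assoc, div_lt_iff₀ (by positivity)]
    nlinarith [le_abs_self K, abs_nonneg K]

/-- A family with dense span that is equivalent to the unit vectors of `c₀` spans a copy
of `c₀`. -/
theorem nonempty_equiv_c0Space [CompleteSpace X] {e : κ → X} {K K' : ℝ}
    (hup : ∀ (s : Finset κ) (c : κ → ℝ) (r : ℝ), 0 ≤ r → (∀ i ∈ s, |c i| ≤ r) →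
      ‖∑ i ∈ s, c i • e i‖ ≤ K * r)
    (hlow : ∀ (s : Finset κ) (c : κ → ℝ), ∀ j ∈ s, |c j| ≤ K' * ‖∑ i ∈ s, c i • e i‖)
    (hspan : (Submodule.span ℝ (Set.range e)).topologicalClosure = ⊤) :
    Nonempty (X ≃L[ℝ] c0Space κ) := by
  classical
  have hsum := summable_smul_of_c0Space hup
  let T₀ : c0Space κ →ₗ[ℝ] X :=
    { toFun := fun y => ∑' i, y.1 i • e i
      map_add' := fun y z => by
        rw [← (hsum y).tsum_add (hsum z)]
        exact tsum_congr fun i => add_smul (y.1 i) (z.1 i) (e i)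
      map_smul' := fun r y => by
        rw [RingHom.id_apply, ← (hsum y).tsum_const_smul r]
        exact tsum_congr fun i => mul_smul r (y.1 i) (e i) }
  have hT₀ : ∀ y, HasSum (fun i => y.1 i • e i) (T₀ y) := fun y => (hsum y).hasSum
  have hbound : ∀ y, ‖T₀ y‖ ≤ K * ‖y‖ := fun y =>
    le_of_tendsto' (hT₀ y).norm fun s => hup s (fun i => y.1 i) ‖y‖ (norm_nonneg _) fun i _ =>
      lp.norm_apply_le_norm ENNReal.top_ne_zero y.1 i
  let T : c0Space κ →L[ℝ] X := T₀.mkContinuous K hbound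
  have hbelow : ∀ y, ‖y‖ ≤ (K'.toNNReal : ℝ) * ‖T y‖ := fun y => by
    refine lp.norm_le_of_forall_le (by positivity) fun j => ?_
    refine ge_of_tendsto ((hT₀ y).norm.const_mul (K'.toNNReal : ℝ)) ?_
    filter_upwards [eventually_ge_atTop {j}] with s hs
    refine (hlow s (fun i => y.1 i) j (hs (Finset.mem_singleton_self j))).trans ?_
    gcongr
    exact Real.le_coe_toNNReal K'
  have hanti : AntilipschitzWith K'.toNNReal T := AddMonoidHomClass.antilipschitz_of_bound T hbelow
  -- A map bounded below on a complete space has closed range; this range contains every `e i`,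
  -- hence the closure of their span.
  have hclosed : IsClosed (T.range : Set X) := hanti.isClosed_range T.uniformContinuous
  have hrange : T.range = ⊤ := by
    rw [eq_top_iff, ← hspan]
    refine Submodule.topologicalClosure_minimal _ (Submodule.span_le.2 ?_) hclosed
    rintro _ ⟨i, rfl⟩
    have hmem : lp.single ∞ i (1 : ℝ) ∈ c0Space κ := by
      change Tendsto (fun γ => lp.single (E := fun _ : κ => ℝ) ∞ i (1 : ℝ) γ) cofinite (𝓝 0)
      refine tendsto_nhds_of_eventually_eq ?_
      filter_upwards [(Set.finite_singleton i).compl_mem_cofinite] with γ hγ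
      exact lp.single_apply_ne _ _ _ hγ
    refine ⟨⟨_, hmem⟩, ?_⟩
    refine (hT₀ ⟨_, hmem⟩).unique ?_
    have h1 := hasSum_single (f := fun k => lp.single (E := fun _ : κ => ℝ) ∞ i (1 : ℝ) k • e k) i
      fun k hk => by rw [lp.single_apply_ne _ _ _ hk, zero_smul]
    simpa using h1
  exact ⟨(ContinuousLinearEquiv.ofBijective T (LinearMap.ker_eq_bot.2 hanti.injective)
    hrange).symm⟩

end Isomorphism

/-! ### Density and the size of the basis -/

section Density

variable {X : Type u} [NormedAddCommGroup X]

theorem mk_le_topDensity_of_separated {ι : Type u} {e : ι → X} {d : ℝ} (hd : 0 < d)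
    (he : ∀ i j, i ≠ j → d ≤ ‖e i - e j‖) : #ι ≤ topDensity X := by
  refine le_csInf ⟨_, Set.univ, dense_univ, rfl⟩ ?_
  rintro _ ⟨s, hs, rfl⟩
  have hex : ∀ i, ∃ y ∈ s, dist (e i) y < d / 2 := fun i => hs.exists_dist_lt (e i) (by positivity)
  choose g hgs hg using hex
  refine Cardinal.mk_le_of_injective (f := fun i => (⟨g i, hgs i⟩ : s)) fun i j hij => ?_
  by_contra hne
  have h1 : g i = g j := congrArg Subtype.val hij
  have h2 := hg j
  rw [← h1] at h2
  have h3 := dist_triangle_right (e i) (e j) (g i)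
  have h4 := he i j hne
  rw [← dist_eq_norm] at h4
  linarith [hg i]

theorem topDensity_le_of_span_dense [NormedSpace ℝ X] {ι : Type u} {e : ι → X}
    (he : (Submodule.span ℝ (Set.range e)).topologicalClosure = ⊤) :
    topDensity X ≤ max #ι ℵ₀ := by
  classical
  -- Rational combinations: their closure is a real subspace containing every `e i`, and there are
  -- at most `max #ι ℵ₀` of them.
  let Φ : (ι →₀ ℚ) → X := fun c => c.sum fun i q => (q : ℝ) • e i
  have hadd : ∀ c c', Φ (c + c') = Φ c + Φ c' := fun c c' =>
    Finsupp.sum_add_index' (fun i => by simp) fun i q q' => by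
      rw [Rat.cast_add, add_smul]
  have hsmul : ∀ (q : ℚ) c, Φ (q • c) = (q : ℝ) • Φ c := fun q c => by
    simp only [Φ]
    rw [Finsupp.sum_smul_index fun i => by simp, Finsupp.smul_sum]
    exact Finsupp.sum_congr fun i _ => by rw [Rat.cast_mul, mul_smul]
  set C : Set X := closure (Set.range Φ) with hC
  have hCadd : ∀ x ∈ C, ∀ y ∈ C, x + y ∈ C := fun x hx y hy => by
    refine map_mem_closure₂ continuous_add hx hy ?_
    rintro _ ⟨c, rfl⟩ _ ⟨c', rfl⟩
    exact ⟨c + c', hadd c c'⟩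
  have hCrat : ∀ (q : ℚ), ∀ x ∈ C, (q : ℝ) • x ∈ C := fun q x hx => by
    refine map_mem_closure (continuous_const_smul (q : ℝ)) hx ?_
    rintro _ ⟨c, rfl⟩
    exact ⟨q • c, hsmul q c⟩
  have hCsmul : ∀ (r : ℝ), ∀ x ∈ C, r • x ∈ C := fun r x hx => by
    have hcl : IsClosed {r : ℝ | r • x ∈ C} :=
      isClosed_closure.preimage (continuous_id.smul continuous_const)
    have hsub : Set.range ((↑) : ℚ → ℝ) ⊆ {r : ℝ | r • x ∈ C} := by
      rintro _ ⟨q, rfl⟩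
      exact hCrat q x hx
    exact closure_minimal hsub hcl (Rat.denseRange_cast r)
  let W : Submodule ℝ X :=
    { carrier := C
      add_mem' := fun {x y} hx hy => hCadd x hx y hy
      zero_mem' := subset_closure ⟨0, Finsupp.sum_zero_index⟩
      smul_mem' := fun r x hx => hCsmul r x hx }
  have hW : (⊤ : Submodule ℝ X) ≤ W := by
    rw [← he]
    refine Submodule.topologicalClosure_minimal _ (Submodule.span_le.2 ?_) isClosed_closure
    rintro _ ⟨i, rfl⟩
    exact subset_closure ⟨Finsupp.single i 1, by simp [Φ, Finsupp.sum_single_index]⟩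
  have hdense : Dense (Set.range Φ) := fun x => hW (Submodule.mem_top (x := x))
  have hle : topDensity X ≤ #(Set.range Φ) := csInf_le' ⟨_, hdense, rfl⟩
  refine hle.trans (Cardinal.mk_range_le.trans ?_)
  cases isEmpty_or_nonempty ι
  · exact (Cardinal.mk_le_aleph0).trans (le_max_right _ _)
  · rw [Cardinal.mk_finsupp_lift_of_infinite']
    simp

end Density

/-! ### The main theorem -/

theorem mainTheorem4 {X : Type u} [NormedAddCommGroup X] [NormedSpace ℝ X] [CompleteSpace X]
    (hdens : ℶ_ Ordinal.omega0.{u} ≤ topDensity X)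
    (o : Ordinal.{u}) (e : Set.Iio o → X) (he : IsSymmetricLongBasis e)
    (Γ : Type v)
    (hemb : (∃ f : X → c0Space Γ, IsCoarseEmb f) ∨ (∃ f : X → c0Space Γ, IsUniformEmb f)) :
    Nonempty (X ≃L[ℝ] c0Space (topDensity X).ord.ToType) := by
  classical
  obtain ⟨f, hf⟩ : ∃ f : X → c0Space Γ, IsCoarseEmb f ∨ IsUniformEmb f := by
    rcases hemb with ⟨f, hf⟩ | ⟨f, hf⟩
    exacts [⟨f, Or.inl hf⟩, ⟨f, Or.inr hf⟩]
  have hbasis := he.isLongSchauderBasis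
  have hreindex : ∀ {κ : Type u} (E : κ ≃ Set.Iio o),
      (Submodule.span ℝ (Set.range (e ∘ E))).topologicalClosure = ⊤ := fun E => by
    rw [E.surjective.range_comp]
    exact hbasis.span_closure_eq_top
  have hsym : IsSymmetricFamily e := he.norm_sum_eq
  -- `Set.Iio o` lives one universe above `X`; `o.ToType` is a copy whose cardinality can be
  -- compared with the density.
  let E₀ : o.ToType ≃ Set.Iio o := (Ordinal.ToType.mk (o := o)).symm.toEquiv
  have hlt : ℵ₀ < ℶ_ Ordinal.omega0.{u} := by
    rw [← Cardinal.beth_zero]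
    exact Cardinal.beth_lt_beth.2 Ordinal.omega0_pos
  have hle : topDensity X ≤ #o.ToType := by
    rcases le_max_iff.1 (topDensity_le_of_span_dense (hreindex E₀)) with h | h
    · exact h
    · exact absurd (hdens.trans h) (not_le.2 hlt)
  have hInf₀ : Infinite o.ToType :=
    Cardinal.aleph0_le_mk_iff.1 (hlt.le.trans (hdens.trans hle))
  obtain ⟨i₀, i₁, h01⟩ := exists_pair_ne o.ToType
  have hd : 0 < ‖e (E₀ i₀) - e (E₀ i₁)‖ :=
    norm_pos_iff.2 (sub_ne_zero.2 (hbasis.injective.ne (E₀.injective.ne h01)))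
  -- By symmetry all distances between distinct basis vectors are equal, so the basis is a separated
  -- set.
  have hcard : #o.ToType = topDensity X :=
    (mk_le_topDensity_of_separated (e := e ∘ E₀) hd fun i j hij =>
      (hsym.norm_sub_eq (E₀.injective.ne h01) (E₀.injective.ne hij)).le).antisymm hle
  have hmk : #(topDensity X).ord.ToType = #o.ToType := by
    rw [Cardinal.mk_toType, Cardinal.card_ord, hcard]
  obtain ⟨E₁⟩ := Cardinal.eq.1 hmk
  let E : (topDensity X).ord.ToType ≃ Set.Iio o := E₁.trans E₀
  have hInf : Infinite (topDensity X).ord.ToType := Infinite.of_injective E₁.symm E₁.symm.injective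
  have hInfo : Infinite (Set.Iio o) := Infinite.of_injective E E.injective
  have hsymE : IsSymmetricFamily (e ∘ E) := hsym.comp E.injective
  have hinjE : Function.Injective (e ∘ E) := hbasis.injective.comp E.injective
  obtain ⟨K, hK⟩ := hsymE.exists_norm_sum_sub_le (by rw [hmk, hcard]; exact hdens) hf
  choose φ hφ hφ' using fun j => hsym.exists_coord hbasis.injective j
  have hz : ∀ z, (∀ j, φ (E j) z = 0) → z = 0 := fun z h =>
    hbasis.eq_zero_of_coord_eq_zero hφ hφ' fun j => by simpa using h (E.symm j)
  have hKE := hsymE.norm_sum_le hK (φ := fun j => φ (E j)) (fun j => hφ (E j))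
    (fun j i hij => hφ' (E j) (E i) (E.injective.ne hij)) hz
  refine nonempty_equiv_c0Space (e := e ∘ E) (K := K) (K' := 2 / ‖e (E₀ i₀) - e (E₀ i₁)‖)
    (fun s c r hr hc => norm_sum_finset_le hKE s c hr hc) (fun s c j hj => ?_) (hreindex E)
  rw [div_mul_eq_mul_div, le_div_iff₀ hd]
  have h := hsymE.abs_coeff_mul_le (E₁.symm.injective.ne h01) s c hj
  simpa [E] using h
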